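/- **Setting.** Let $AP$ be a finite set of atomic propositions and $N\in\mathbb N$. For $n\in[N]=\{1,\dots,N\}$ let $T_n=(S_n,\to_n,AP,L_n)$ be a transition system ($S_n$ a finite set of states, $\to_n\subseteq S_n\times S_n$, $L_n:S_n\to 2^{AP}$) with an initial state $s_n^0\in S_n$. A trajectory of $T_n$ is a sequence $\pi_n:\mathbb N\to S_n$ with $\pi_n(k)\to_n\pi_n(k+1)$ for all $k$; its trace is $\sigma(\pi_n)=L_n(\pi_n(0))L_n(\pi_n(1))\cdots$. Inner formulas are the LTL formulas $\phi::=\mathrm{True}\mid a\mid\neg\phi\mid\phi_1\wedge\phi_2\mid\bigcirc\phi\mid\phi_1\,\mathcal U\,\phi_2$ with $a\in AP$ and the usual semantics $\sigma,t\models\phi$ over traces. cLTL+ formulas are $\mu::=\mathrm{True}\mid[\phi,m]\mid\neg\mu\mid\mu_1\wedge\mu_2\mid\bigcirc\mu\mid\mu_1\,\mathcal U\,\mu_2$, with $\phi$ an inner formula and $m\in\mathbb N$. For a collection $\Pi=\{\pi_1,\dots,\pi_N\}$ and local counters $K=[k_1\dots k_N]$, one has $(\Pi,K),t\models[\phi,m]$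 iff $|\{n:\sigma(\pi_n),k_n(t)\models\phi\}|\ge m$, and the other operators have their LTL semantics in $t$. The globally synchronous execution $K^*$ has $k_n^*(t)=t$ for all $n,t$. **Problem 1.** Given $\{T_n\}$, $\{s_n^0\}$ and a cLTL+ formula $\mu$, find trajectories $\pi_n$ of $T_n$ with $\pi_n(0)=s_n^0$ such that $(\Pi,K^*),0\models\mu$. **The integer program with horizon $h\geq 1$.** Let $A_n$ be the 0-1 matrix with $(A_n)_{s',s}=1$ iff $s\to_n s'$, and let $M$ be a real number with $M\ge N+1$ and $M\ge m$ for every $[\phi,m]$ occurring in $\mu$. The variables are binary: state vectors $w_n(t)\in\{0,1\}^{S_n}$ ($0\le t\le h$), loop variables $z^{loop}_t$, variables $z^{\phi,n}_t$ for the inner formulas $\phi$ occurring in $\mu$, variables $y^\nu_t$ for the outer subformulas $\nu$ of $\mu$ ($0\le t\le h-1$), and auxiliary variables. The constraints are, for all $n\in[N]$ and $0\le t\le h-1$: * (dynamics) $w_n(0)=e_{s_n^0}$, $w_n(t+1)\le A_nw_n(t)$, $\mathbf 1^Tw_n(t)=1$; * (loop) $w_n(t)-\mathbf 1(1-z^{loop}_t)\le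 w_n(h)\le w_n(t)+\mathbf 1(1-z^{loop}_t)$ and $\sum_{t=0}^{h-1}z^{loop}_t=1$; * (inner formulas) $z^{\mathrm{True},n}_t=1$; for $a\in AP$, with $v_n^a\in\{0,1\}^{S_n}$ the indicator of $\{s:a\in L_n(s)\}$, $z^{a,n}_t\le (v_n^a)^Tw_n(t)<z^{a,n}_t+1$; $z^{\neg\varphi,n}_t=1-z^{\varphi,n}_t$; $z^{\varphi_1\wedge\varphi_2,n}_t=z^{\varphi_1,n}_t\wedge z^{\varphi_2,n}_t$; for $\phi=\bigcirc\varphi$, $z^{\phi,n}_t=z^{\varphi,n}_{t+1}$ for $t\le h-2$ and $z^{\phi,n}_{h-1}=\bigvee_{t=0}^{h-1}(z^{\varphi,n}_t\wedge z^{loop}_t)$; for $\phi=\varphi_1\,\mathcal U\,\varphi_2$, with auxiliary binary variables $\tilde z^{\phi,n}_t$, $$z^{\phi,n}_t=z^{\varphi_2,n}_t\vee(z^{\varphi_1,n}_t\wedge z^{\phi,n}_{t+1}),\qquad \tilde z^{\phi,n}_t=z^{\varphi_2,n}_t\vee(z^{\varphi_1,n}_t\wedge\tilde z^{\phi,n}_{t+1})\qquad(t\le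 h-2),$$ $$z^{\phi,n}_{h-1}=z^{\varphi_2,n}_{h-1}\vee\Big(z^{\varphi_1,n}_{h-1}\wedge\bigvee_{t=0}^{h-1}(z^{loop}_t\wedge\tilde z^{\phi,n}_t)\Big),\qquad \tilde z^{\phi,n}_{h-1}=z^{\varphi_2,n}_{h-1};$$ * (outer formulas) the same constraints with $y$ in place of $z$ for $\mathrm{True},\neg,\wedge,\bigcirc,\mathcal U$, and for $\nu=[\phi,m]$: $\ m>\sum_{n=1}^Nz^{\phi,n}_t-My^\nu_t\ge m-M$; * $y^\mu_0=1$. Here Boolean equations between binary variables stand for linear inequalities: $x=\bigwedge_{i=1}^Ix_i$ for $x\le x_i$ (all $i$) and $x\ge 1-I+\sum_ix_i$; $x=\bigvee_{i=1}^Ix_i$ for $x\ge x_i$ (all $i$) and $x\le\sum_ix_i$; nested ones use auxiliary binary variables. **Theorem (completeness of the synchronous encoding).** If Problem 1 has a solution, then there is a finite horizon $h\ge1$ for which the integer program above is feasible. -/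

import Mathlib

namespace CLTL

/-! ### Transition systems, trajectories, executions -/

/-- A transition system with state set `S` and atomic propositions `AP`
(both are required to be finite where transition systems are used). -/
structure TransitionSystem (S : Type*) (AP : Type*) where
  /-- `trans s s'` means that there is a transition from `s` to `s'`. -/
  trans : S → S → Prop
  label : S → Set AP

/-- Infinite sequences of states that follow the transition relation. -/
def TransitionSystem.IsTrajectory {S AP : Type*} (T : TransitionSystem S AP) (p : ℕ → S) : Prop :=
  ∀ k, T.trans (p k) (p (k + 1))

/-- The trace of a sequence of states. -/
def TransitionSystem.trace {S AP : Type*} (T : TransitionSystem S AP) (p : ℕ → S) : ℕ → Set AP :=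
  fun k => T.label (p k)

/-- Local counters. -/
def IsLocalCounter (k : ℕ → ℕ) : Prop :=
  k 0 = 0 ∧ (∀ t, k t ≤ k (t + 1) ∧ k (t + 1) ≤ k t + 1) ∧
    Filter.Tendsto k Filter.atTop Filter.atTop

/-- `N`-dimensional collective executions: one local counter for each robot. -/
structure CollectiveExecution (N : ℕ) where
  counter : Fin N → ℕ → ℕ
  isLocalCounter : ∀ n, IsLocalCounter (counter n)

/-- The globally synchronous collective execution. -/
def globallySynchronous (N : ℕ) : CollectiveExecution N where
  counter := fun _ t => t
  isLocalCounter := fun _ =>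
    ⟨rfl, fun t => ⟨Nat.le_succ t, le_refl (t + 1)⟩, Filter.tendsto_id⟩

/-! ### Syntax and semantics of cLTL+ -/

/-- Inner logic formulas (LTL). -/
inductive InnerFormula (AP : Type*) where
  | tru : InnerFormula AP
  | ap : AP → InnerFormula AP
  | not : InnerFormula AP → InnerFormula AP
  | and : InnerFormula AP → InnerFormula AP → InnerFormula AP
  | next : InnerFormula AP → InnerFormula AP
  | until : InnerFormula AP → InnerFormula AP → InnerFormula AP

/-- Satisfaction of an inner formula by a trace at a given step. -/
def InnerFormula.Sat {AP : Type*} (σ : ℕ → Set AP) : InnerFormula AP → ℕ → Prop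
  | .tru, _ => True
  | .ap a, t => a ∈ σ t
  | .not φ, t => ¬ InnerFormula.Sat σ φ t
  | .and φ₁ φ₂, t => InnerFormula.Sat σ φ₁ t ∧ InnerFormula.Sat σ φ₂ t
  | .next φ, t => InnerFormula.Sat σ φ (t + 1)
  | .until φ₁ φ₂, t => ∃ l, InnerFormula.Sat σ φ₂ (t + l) ∧
      ∀ l' < l, InnerFormula.Sat σ φ₁ (t + l')

/-- cLTL+ formulas. `tcp φ m` is the temporal counting proposition `[φ, m]`. -/
inductive Formula (AP : Type*) where
  | tru : Formula AP
  | tcp : InnerFormula AP → ℕ → Formula AP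
  | not : Formula AP → Formula AP
  | and : Formula AP → Formula AP → Formula AP
  | next : Formula AP → Formula AP
  | until : Formula AP → Formula AP → Formula AP

/-- The numbers `m` of the temporal counting propositions `[φ, m]` that occur in a formula. -/
def Formula.thresholds {AP : Type*} : Formula AP → Set ℕ
  | .tru => ∅
  | .tcp _ m => {m}
  | .not μ => μ.thresholds
  | .and μ₁ μ₂ => μ₁.thresholds ∪ μ₂.thresholds
  | .next μ => μ.thresholds
  | .until μ₁ μ₂ => μ₁.thresholds ∪ μ₂.thresholds

section Semantics

variable {AP : Type*} {N : ℕ} {S : Fin N → Type*}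

/-- Satisfaction of a cLTL+ formula by a collection `p` of trajectories, interleaved according to
the collective execution `K`, at a given time. -/
def Formula.Sat (T : ∀ n, TransitionSystem (S n) AP) (p : ∀ n, ℕ → S n)
    (K : CollectiveExecution N) : Formula AP → ℕ → Prop
  | .tru, _ => True
  | .tcp φ m, t => m ≤ Set.ncard {n : Fin N | φ.Sat ((T n).trace (p n)) (K.counter n t)}
  | .not μ, t => ¬ Formula.Sat T p K μ t
  | .and μ₁ μ₂, t => Formula.Sat T p K μ₁ t ∧ Formula.Sat T p K μ₂ t
  | .next μ, t => Formula.Sat T p K μ (t + 1)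
  | .until μ₁ μ₂, t => ∃ l, Formula.Sat T p K μ₂ (t + l) ∧
      ∀ l' < l, Formula.Sat T p K μ₁ (t + l')

/-- The collection `p` solves the synchronous coordination problem with dynamics `T`, initial
conditions `s₀` and specification `μ`. -/
def IsSolution (T : ∀ n, TransitionSystem (S n) AP) (s₀ : ∀ n, S n) (μ : Formula AP)
    (p : ∀ n, ℕ → S n) : Prop :=
  (∀ n, (T n).IsTrajectory (p n) ∧ p n 0 = s₀ n) ∧
    μ.Sat T p (globallySynchronous N) 0

end Semantics

/-! ### Constraints on binary variables -/

/-- `x` is a binary value. -/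
def IsBinary (x : ℤ) : Prop := x = 0 ∨ x = 1

/-- The linear inequalities that encode `x = a ∧ b`. -/
def ConjConstraint (x a b : ℤ) : Prop :=
  x ≤ a ∧ x ≤ b ∧ 1 - 2 + (a + b) ≤ x

/-- The linear inequalities that encode `x = a ∨ b`. -/
def DisjConstraint (x a b : ℤ) : Prop :=
  a ≤ x ∧ b ≤ x ∧ x ≤ a + b

/-- The linear inequalities that encode `x = ⋁_{t < h} a t`. -/
def BigDisjConstraint (h : ℕ) (x : ℤ) (a : ℕ → ℤ) : Prop :=
  (∀ t < h, a t ≤ x) ∧ x ≤ ∑ t ∈ Finset.range h, a t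

/-- The encoding of `x = a ∨ (b ∧ c)`, with an auxiliary binary variable for the conjunction. -/
def DisjConjConstraint (x a b c : ℤ) : Prop :=
  ∃ u, IsBinary u ∧ ConjConstraint u b c ∧ DisjConstraint x a u

/-- The encoding of `x = ⋁_{t < h} (zloop t ∧ a t)`, with auxiliary binary variables for the
conjunctions. -/
def LoopConstraint (h : ℕ) (zloop : ℕ → ℤ) (x : ℤ) (a : ℕ → ℤ) : Prop :=
  ∃ u : ℕ → ℤ, (∀ t < h, IsBinary (u t) ∧ ConjConstraint (u t) (zloop t) (a t)) ∧
    BigDisjConstraint h x u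

/-- The constraints on the variables `z` of `¬ φ`, given the variables `a` of `φ`. -/
def NotConstraint (h : ℕ) (z a : ℕ → ℤ) : Prop :=
  ∀ t < h, z t = 1 - a t

/-- The constraints on the variables `z` of `φ₁ ∧ φ₂`, given the variables `a` of `φ₁` and `b`
of `φ₂`. -/
def AndConstraint (h : ℕ) (z a b : ℕ → ℤ) : Prop :=
  ∀ t < h, ConjConstraint (z t) (a t) (b t)

/-- The constraints on the variables `z` of `◯ φ`, given the variables `a` of `φ`. -/
def NextConstraint (h : ℕ) (zloop z a : ℕ → ℤ) : Prop :=
  (∀ t, t + 1 < h → z t = a (t + 1)) ∧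
  (∀ t, t + 1 = h → LoopConstraint h zloop (z t) a)

/-- The constraints on the variables `z` and on the auxiliary binary variables `z'` of `φ₁ U φ₂`,
given the variables `a` of `φ₁` and `b` of `φ₂`. -/
def UntilConstraint (h : ℕ) (zloop z z' a b : ℕ → ℤ) : Prop :=
  (∀ t < h, IsBinary (z' t)) ∧
  (∀ t, t + 1 < h → DisjConjConstraint (z t) (b t) (a t) (z (t + 1))) ∧
  (∀ t, t + 1 = h → ∃ v, IsBinary v ∧ LoopConstraint h zloop v z' ∧
    DisjConjConstraint (z t) (b t) (a t) v) ∧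
  (∀ t, t + 1 < h → DisjConjConstraint (z' t) (b t) (a t) (z' (t + 1))) ∧
  (∀ t, t + 1 = h → z' t = b t)

/-! ### The integer linear program -/

section ILP

variable {AP : Type*} {N : ℕ} {S : Fin N → Type*}

/-- The decision variables. Only the variables with time index below the horizon (up to and
including the horizon for `w`) and only those attached to subformulas of the specification are
constrained; the others play no role. -/
structure Variables (AP : Type*) {N : ℕ} (S : Fin N → Type*) where
  /-- `w n t` is the state vector of robot `n` at time `t`. -/
  w : ∀ n, ℕ → S n → ℤ
  /-- The loop variables. -/
  zloop : ℕ → ℤ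
  /-- The variables of the inner formulas, for each robot and time. -/
  z : InnerFormula AP → Fin N → ℕ → ℤ
  /-- The auxiliary variables of the inner until formulas. -/
  zAux : InnerFormula AP → Fin N → ℕ → ℤ
  /-- The variables of the outer formulas, for each time. -/
  y : Formula AP → ℕ → ℤ
  /-- The auxiliary variables of the outer until formulas. -/
  yAux : Formula AP → ℕ → ℤ

open Classical in
/-- The adjacency matrix, with the convention that column `s` lists the successors of `s`, so that
`A *ᵥ w` marks the successors of the state marked by `w`. -/
noncomputable def TransitionSystem.adj {S AP : Type*} (T : TransitionSystem S AP) :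
    Matrix S S ℤ :=
  Matrix.of fun s' s => if T.trans s s' then 1 else 0

open Classical in
/-- The 0-1 vector of the states at which the atomic proposition `a` holds. -/
noncomputable def TransitionSystem.labelVec {S AP : Type*} (T : TransitionSystem S AP) (a : AP) :
    S → ℤ :=
  fun s => if a ∈ T.label s then 1 else 0

open Classical in
/-- The constraints for the dynamics of the robots. -/
def DynamicsConstraints [∀ n, Fintype (S n)] (T : ∀ n, TransitionSystem (S n) AP) (s₀ : ∀ n, S n)
    (h : ℕ) (v : Variables AP S) : Prop :=
  ∀ n, (∀ t ≤ h, ∀ s, IsBinary (v.w n t s)) ∧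
    v.w n 0 = Pi.single (s₀ n) 1 ∧
    ∀ t < h, v.w n (t + 1) ≤ (T n).adj.mulVec (v.w n t) ∧ ∑ s, v.w n t s = 1

/-- The constraints that force the state sequences to close a loop. -/
def LoopConstraints (h : ℕ) (v : Variables AP S) : Prop :=
  (∀ t < h, IsBinary (v.zloop t)) ∧
  (∀ n, ∀ t < h, ∀ s,
    v.w n h s ≤ v.w n t s + (1 - v.zloop t) ∧ v.w n t s - (1 - v.zloop t) ≤ v.w n h s) ∧
  ∑ t ∈ Finset.range h, v.zloop t = 1

/-- The constraints on the variables of an inner formula and, recursively, of its subformulas, for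
robot `n`. -/
def InnerILP [∀ n, Fintype (S n)] (T : ∀ n, TransitionSystem (S n) AP) (h : ℕ)
    (v : Variables AP S) (n : Fin N) : InnerFormula AP → Prop
  | .tru => ∀ t < h, v.z .tru n t = 1
  | .ap a => ∀ t < h, IsBinary (v.z (.ap a) n t) ∧
      v.z (.ap a) n t ≤ (T n).labelVec a ⬝ᵥ v.w n t ∧
      (T n).labelVec a ⬝ᵥ v.w n t < v.z (.ap a) n t + 1
  | .not φ => InnerILP T h v n φ ∧ (∀ t < h, IsBinary (v.z (.not φ) n t)) ∧
      NotConstraint h (v.z (.not φ) n) (v.z φ n)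
  | .and φ₁ φ₂ => InnerILP T h v n φ₁ ∧ InnerILP T h v n φ₂ ∧
      (∀ t < h, IsBinary (v.z (.and φ₁ φ₂) n t)) ∧
      AndConstraint h (v.z (.and φ₁ φ₂) n) (v.z φ₁ n) (v.z φ₂ n)
  | .next φ => InnerILP T h v n φ ∧ (∀ t < h, IsBinary (v.z (.next φ) n t)) ∧
      NextConstraint h v.zloop (v.z (.next φ) n) (v.z φ n)
  | .until φ₁ φ₂ => InnerILP T h v n φ₁ ∧ InnerILP T h v n φ₂ ∧
      (∀ t < h, IsBinary (v.z (.until φ₁ φ₂) n t)) ∧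
      UntilConstraint h v.zloop (v.z (.until φ₁ φ₂) n) (v.zAux (.until φ₁ φ₂) n)
        (v.z φ₁ n) (v.z φ₂ n)

/-- The constraints on the variables of a cLTL+ formula and, recursively, of all outer and inner
formulas that occur in it. `M` is the big constant of the counting constraints. -/
def OuterILP [∀ n, Fintype (S n)] (T : ∀ n, TransitionSystem (S n) AP) (M : ℝ) (h : ℕ)
    (v : Variables AP S) : Formula AP → Prop
  | .tru => ∀ t < h, v.y .tru t = 1
  | .tcp φ m => (∀ n, InnerILP T h v n φ) ∧ ∀ t < h, IsBinary (v.y (.tcp φ m) t) ∧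
      (m : ℝ) > ∑ n, (v.z φ n t : ℝ) - M * (v.y (.tcp φ m) t : ℝ) ∧
      ∑ n, (v.z φ n t : ℝ) - M * (v.y (.tcp φ m) t : ℝ) ≥ (m : ℝ) - M
  | .not μ => OuterILP T M h v μ ∧ (∀ t < h, IsBinary (v.y (.not μ) t)) ∧
      NotConstraint h (v.y (.not μ)) (v.y μ)
  | .and μ₁ μ₂ => OuterILP T M h v μ₁ ∧ OuterILP T M h v μ₂ ∧
      (∀ t < h, IsBinary (v.y (.and μ₁ μ₂) t)) ∧
      AndConstraint h (v.y (.and μ₁ μ₂)) (v.y μ₁) (v.y μ₂)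
  | .next μ => OuterILP T M h v μ ∧ (∀ t < h, IsBinary (v.y (.next μ) t)) ∧
      NextConstraint h v.zloop (v.y (.next μ)) (v.y μ)
  | .until μ₁ μ₂ => OuterILP T M h v μ₁ ∧ OuterILP T M h v μ₂ ∧
      (∀ t < h, IsBinary (v.y (.until μ₁ μ₂) t)) ∧
      UntilConstraint h v.zloop (v.y (.until μ₁ μ₂)) (v.yAux (.until μ₁ μ₂)) (v.y μ₁) (v.y μ₂)

/-- Feasibility of the integer linear program with horizon `h`. -/
def Feasible [∀ n, Fintype (S n)] (T : ∀ n, TransitionSystem (S n) AP) (s₀ : ∀ n, S n)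
    (μ : Formula AP) (M : ℝ) (h : ℕ) : Prop :=
  ∃ v : Variables AP S, DynamicsConstraints T s₀ h v ∧ LoopConstraints h v ∧
    OuterILP T M h v μ ∧ v.y μ 0 = 1

end ILP

end CLTL

namespace CLTL

open Filter

/-! ### Recurrence along a nonprincipal ultrafilter -/

/-! No lasso-shaped solution is built. The given trajectories are kept, every variable is the truth
value of its formula along them (`truthVariables`), and only the loop start `l` and the horizon `h`
are chosen. Away from the horizon the constraints are the local laws of the operators. At `h - 1`
the program reads values at `l` in place of those at `h`, so it suffices that `l < h`, that states
and the relevant truth values agree at `l` and `h`, and that each until formula true at `l` is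
fulfilled before `h`. Each requirement holds for ultrafilter-many `l` and then, for each such `l`,
ultrafilter-many `h` (`recurs_eq`, `recurs_iff`, `recurs_untilBefore`). Such relations are closed
under finite intersection, so an induction on formulas (`recurs_innerILP`, `recurs_outerILP`)
collects them all without listing subformulas. -/

/-- `R l h` holds for all `l` and all `h` that are large with respect to the hyperfilter. -/
def Recurs (R : ℕ → ℕ → Prop) : Prop :=
  ∀ᶠ l in (hyperfilter ℕ : Filter ℕ), ∀ᶠ h in (hyperfilter ℕ : Filter ℕ), R l h

theorem Recurs.and {R R' : ℕ → ℕ → Prop} (hR : Recurs R) (hR' : Recurs R') :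
    Recurs fun l h => R l h ∧ R' l h := by
  filter_upwards [hR, hR'] with l h₁ h₂
  exact h₁.and h₂

theorem Recurs.mono {R R' : ℕ → ℕ → Prop} (hR : Recurs R) (H : ∀ l h, R l h → R' l h) :
    Recurs R' :=
  Eventually.mono hR fun l hl => hl.mono (H l)

theorem Recurs.forall {ι : Type*} [Finite ι] {R : ι → ℕ → ℕ → Prop} (hR : ∀ i, Recurs (R i)) :
    Recurs fun l h => ∀ i, R i l h := by
  filter_upwards [eventually_all.2 hR] with l hl
  exact eventually_all.2 hl

theorem Recurs.exists {R : ℕ → ℕ → Prop} (hR : Recurs R) : ∃ l h, R l h :=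
  let ⟨l, hl⟩ := Eventually.exists hR
  ⟨l, Eventually.exists hl⟩

/-- The nested quantifiers let the bound on `h` depend on `l`. -/
theorem Recurs.of_atTop {R : ℕ → ℕ → Prop} (hR : ∀ l, ∀ᶠ h in atTop, R l h) : Recurs R :=
  Eventually.of_forall fun l => Nat.hyperfilter_le_atTop (hR l)

theorem recurs_lt : Recurs fun l h => l < h :=
  Recurs.of_atTop eventually_gt_atTop

/-- An ultrafilter contains `p` or its complement; `l` and `h` are both taken from whichever set it
contains. -/
theorem recurs_iff (p : ℕ → Prop) : Recurs fun l h => (p l ↔ p h) := by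
  rcases (hyperfilter ℕ).em p with hp | hp
  · filter_upwards [hp] with l hl
    filter_upwards [hp] with h hh
    exact iff_of_true hl hh
  · filter_upwards [hp] with l hl
    filter_upwards [hp] with h hh
    exact iff_of_false hl hh

theorem recurs_eq {α : Type*} [Finite α] (f : ℕ → α) : Recurs fun l h => f l = f h :=
  (Recurs.forall fun a => recurs_iff fun t => f t = a).mono fun l _ H => ((H (f l)).1 rfl).symm

/-! ### Truth values -/

open Classical in
/-- The truth value of a proposition, as an integer. -/
noncomputable def ind (p : Prop) : ℤ := if p then 1 else 0

theorem ind_of_true {p : Prop} (hp : p) : ind p = 1 := if_pos hp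

theorem ind_of_false {p : Prop} (hp : ¬ p) : ind p = 0 := if_neg hp

theorem isBinary_ind (p : Prop) : IsBinary (ind p) := by
  by_cases hp : p
  · exact .inr (ind_of_true hp)
  · exact .inl (ind_of_false hp)

theorem ind_not (p : Prop) : ind (¬ p) = 1 - ind p := by
  by_cases hp : p <;> simp [ind, hp]

theorem conjConstraint_ind {x a b : Prop} (hx : x ↔ a ∧ b) :
    ConjConstraint (ind x) (ind a) (ind b) := by
  by_cases ha : a <;> by_cases hb : b <;> simp [ConjConstraint, ind, hx, ha, hb]

theorem disjConstraint_ind {x a b : Prop} (hx : x ↔ a ∨ b) :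
    DisjConstraint (ind x) (ind a) (ind b) := by
  by_cases ha : a <;> by_cases hb : b <;> simp [DisjConstraint, ind, hx, ha, hb]

theorem disjConjConstraint_ind {x a b c : Prop} (hx : x ↔ a ∨ (b ∧ c)) :
    DisjConjConstraint (ind x) (ind a) (ind b) (ind c) :=
  ⟨ind (b ∧ c), isBinary_ind _, conjConstraint_ind Iff.rfl, disjConstraint_ind hx⟩

theorem sum_ind_eq {l h : ℕ} (hlh : l < h) : ∑ t ∈ Finset.range h, ind (t = l) = 1 := by
  rw [Finset.sum_eq_single l (fun t _ ht => ind_of_false ht)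
    fun hl => absurd (Finset.mem_range.2 hlh) hl]
  exact ind_of_true rfl

/-- The loop variable vanishes except at `l`, so the disjunction reduces to `a l`. -/
theorem loopConstraint_ind {l h : ℕ} (hlh : l < h) {x : Prop} {a : ℕ → Prop} (hx : a l ↔ x) :
    LoopConstraint h (fun t => ind (t = l)) (ind x) fun t => ind (a t) := by
  refine ⟨fun t => ind (t = l ∧ a t), fun t _ => ⟨isBinary_ind _, conjConstraint_ind Iff.rfl⟩,
    fun t _ => ?_, ?_⟩
  · change ind (t = l ∧ a t) ≤ ind x
    by_cases ht : t = l ∧ a t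
    · obtain ⟨rfl, ha⟩ := ht
      simp [ind, ha, hx.1 ha]
    · rw [ind_of_false ht]
      rcases isBinary_ind x with hx' | hx' <;> simp [hx']
  -- The term at `l` alone equals `ind x`; the others are nonnegative.
  · refine le_trans (le_of_eq ?_) (Finset.single_le_sum (f := fun t => ind (t = l ∧ a t))
      (fun t _ => ?_) (Finset.mem_range.2 hlh))
    · simp [hx]
    · rcases isBinary_ind (t = l ∧ a t) with ht | ht <;> simp [ht]

theorem nextConstraint_ind {l h : ℕ} (hlh : l < h) {a : ℕ → Prop} (ha : a l ↔ a h) :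
    NextConstraint h (fun t => ind (t = l)) (fun t => ind (a (t + 1))) fun t => ind (a t) := by
  refine ⟨fun t _ => rfl, ?_⟩
  rintro t rfl
  exact loopConstraint_ind hlh ha

/-! ### Until operators -/

/-- `a` holds from `t` on until `b` does. -/
def UntilAt (a b : ℕ → Prop) (t : ℕ) : Prop :=
  ∃ l, b (t + l) ∧ ∀ l' < l, a (t + l')

/-- `a` holds from `t` on until `b` does, which happens before `h`. -/
def UntilBefore (h : ℕ) (a b : ℕ → Prop) (t : ℕ) : Prop :=
  ∃ l, t + l < h ∧ b (t + l) ∧ ∀ l' < l, a (t + l')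

theorem untilAt_iff (a b : ℕ → Prop) (t : ℕ) :
    UntilAt a b t ↔ b t ∨ (a t ∧ UntilAt a b (t + 1)) := by
  constructor
  · rintro ⟨_ | k, hb, ha⟩
    · exact .inl hb
    · refine .inr ⟨ha 0 k.succ_pos, k, by rwa [add_assoc, add_comm 1], fun k' hk' => ?_⟩
      rw [add_assoc, add_comm 1]
      exact ha _ (Nat.succ_lt_succ hk')
  · rintro (hb | ⟨ha, k, hb, hk⟩)
    · exact ⟨0, hb, fun _ h => absurd h (Nat.not_lt_zero _)⟩
    · refine ⟨k + 1, by rwa [add_assoc, add_comm 1] at hb, fun k' hk' => ?_⟩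
      rcases k' with _ | k'
      · exact ha
      · have := hk k' (Nat.lt_of_succ_lt_succ hk')
        rwa [add_assoc, add_comm 1] at this

/-- Putting the bound into the target lets the bounded until inherit the expansion law
`untilAt_iff`. -/
theorem untilBefore_iff_untilAt (h : ℕ) (a b : ℕ → Prop) (t : ℕ) :
    UntilBefore h a b t ↔ UntilAt a (fun s => s < h ∧ b s) t := by
  simp only [UntilBefore, UntilAt, and_assoc]

theorem untilBefore_iff {h t : ℕ} (a b : ℕ → Prop) (ht : t < h) :
    UntilBefore h a b t ↔ b t ∨ (a t ∧ UntilBefore h a b (t + 1)) := by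
  rw [untilBefore_iff_untilAt, untilBefore_iff_untilAt, untilAt_iff]
  simp only [ht, true_and]

theorem not_untilBefore_self (h : ℕ) (a b : ℕ → Prop) : ¬ UntilBefore h a b h :=
  fun ⟨l, hl, _⟩ => absurd hl (Nat.not_lt.2 (Nat.le_add_right h l))

theorem UntilBefore.untilAt {h t : ℕ} {a b : ℕ → Prop} (H : UntilBefore h a b t) :
    UntilAt a b t :=
  let ⟨l, _, hl⟩ := H
  ⟨l, hl⟩

/-- For fixed `l`, any `h` beyond one witness of the until works; if there is no witness, both sides
fail. -/
theorem recurs_untilBefore (a b : ℕ → Prop) :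
    Recurs fun l h => (UntilBefore h a b l ↔ UntilAt a b l) := by
  refine Recurs.of_atTop fun l => ?_
  by_cases H : UntilAt a b l
  · obtain ⟨k, hk⟩ := id H
    filter_upwards [eventually_gt_atTop (l + k)] with h hh
    exact iff_of_true ⟨k, hh, hk⟩ H
  · exact Eventually.of_forall fun h => iff_of_false (fun H' => H H'.untilAt) H

/-- The auxiliary variables see only witnesses before `h`. The loop feeds their value at `l` back to
step `h - 1`, where the expansion law needs the until at `h`; `hb.trans hu` identifies the two. -/
theorem untilConstraint_ind {l h : ℕ} (hlh : l < h) {a b : ℕ → Prop}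
    (hu : UntilAt a b l ↔ UntilAt a b h) (hb : UntilBefore h a b l ↔ UntilAt a b l) :
    UntilConstraint h (fun t => ind (t = l)) (fun t => ind (UntilAt a b t))
      (fun t => ind (UntilBefore h a b t)) (fun t => ind (a t)) fun t => ind (b t) := by
  refine ⟨fun t _ => isBinary_ind _, fun t _ => disjConjConstraint_ind (untilAt_iff a b t), ?_,
    fun t ht => disjConjConstraint_ind (untilBefore_iff a b (Nat.lt_of_succ_lt ht)), ?_⟩
  · rintro t rfl
    exact ⟨ind (UntilAt a b (t + 1)), isBinary_ind _, loopConstraint_ind hlh (hb.trans hu),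
      disjConjConstraint_ind (untilAt_iff a b t)⟩
  · rintro t rfl
    refine congrArg ind (propext ?_)
    -- The horizon is `t + 1`, so the recursive term is false and only `b t` remains.
    rw [untilBefore_iff a b t.lt_succ_self]
    simp [not_untilBefore_self]

/-! ### The assignment of truth values along a collection of trajectories -/

section Assignment

variable {AP : Type*} {N : ℕ} {S : Fin N → Type*}

open Classical in
/-- The variables given by the truth values of all formulas along the collection `p`, for the
horizon `h` and a loop that starts at `l`. -/
noncomputable def truthVariables (T : ∀ n, TransitionSystem (S n) AP) (p : ∀ n, ℕ → S n)
    (l h : ℕ) : Variables AP S where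
  w n t := Pi.single (p n t) 1
  zloop t := ind (t = l)
  z φ n t := ind (φ.Sat ((T n).trace (p n)) t)
  zAux
    | .until φ₁ φ₂, n, t =>
      ind (UntilBefore h (φ₁.Sat ((T n).trace (p n))) (φ₂.Sat ((T n).trace (p n))) t)
    -- Arbitrary: only until formulas have constrained auxiliary variables.
    | _, _, _ => 0
  y μ t := ind (μ.Sat T p (globallySynchronous N) t)
  yAux
    | .until μ₁ μ₂, t =>
      ind (UntilBefore h (μ₁.Sat T p (globallySynchronous N))
        (μ₂.Sat T p (globallySynchronous N)) t)
    | _, _ => 0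

variable (T : ∀ n, TransitionSystem (S n) AP) (p : ∀ n, ℕ → S n)

theorem loopConstraints_truthVariables {l h : ℕ} (hlh : l < h) (hp : ∀ n, p n l = p n h) :
    LoopConstraints h (truthVariables T p l h) := by
  classical
  refine ⟨fun t _ => isBinary_ind _, fun n t _ s => ?_, sum_ind_eq hlh⟩
  by_cases ht : t = l
  · subst ht
    simp [truthVariables, ind, hp]
  -- Off the loop start the slack is 1, which absorbs any difference of 0-1 entries.
  · by_cases h₁ : s = p n t <;> by_cases h₂ : s = p n h <;>
      simp [truthVariables, ind, ht, Pi.single_apply, h₁, h₂] <;> split_ifs <;> simp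

variable [∀ n, Fintype (S n)]

theorem dynamicsConstraints_truthVariables {s₀ : ∀ n, S n}
    (hp : ∀ n, (T n).IsTrajectory (p n) ∧ p n 0 = s₀ n) (l h : ℕ) :
    DynamicsConstraints T s₀ h (truthVariables T p l h) := by
  classical
  refine fun n => ⟨fun t _ s => ?_, ?_, fun t _ => ⟨fun s => ?_, ?_⟩⟩
  · by_cases hs : s = p n t <;> simp [truthVariables, IsBinary, hs]
  · simp [truthVariables, (hp n).2]
  · by_cases hs : s = p n (t + 1)
    · subst hs
      simp [truthVariables, TransitionSystem.adj, (hp n).1 t]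
    · simp only [truthVariables, Pi.single_apply, hs, if_false, Matrix.mulVec_single_one,
        Matrix.col_apply, TransitionSystem.adj, Matrix.of_apply]
      split_ifs <;> simp
  · simp [truthVariables]

theorem labelVec_dotProduct_truthVariables (a : AP) (n : Fin N) (l h t : ℕ) :
    (T n).labelVec a ⬝ᵥ (truthVariables T p l h).w n t = ind (a ∈ (T n).label (p n t)) := by
  classical
  simp [truthVariables, TransitionSystem.labelVec, ind]

/-- Only `next` and `until` add requirements on `l` and `h`: the operand of `next`, but the whole
`until` formula, must agree at both times. -/
theorem recurs_innerILP (n : Fin N) : ∀ φ : InnerFormula AP,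
    Recurs fun l h => InnerILP T h (truthVariables T p l h) n φ
  | .tru =>
    Recurs.of_atTop fun _ => Eventually.of_forall fun _ _ _ => ind_of_true trivial
  | .ap a => by
    refine Recurs.of_atTop fun _ => Eventually.of_forall fun _ _ _ => ⟨isBinary_ind _, ?_⟩
    rw [labelVec_dotProduct_truthVariables]
    exact ⟨le_rfl, lt_add_one _⟩
  | .not φ =>
    (recurs_innerILP n φ).mono fun _ _ H =>
      ⟨H, fun _ _ => isBinary_ind _, fun _ _ => ind_not _⟩
  | .and φ₁ φ₂ =>
    ((recurs_innerILP n φ₁).and (recurs_innerILP n φ₂)).mono fun _ _ H =>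
      ⟨H.1, H.2, fun _ _ => isBinary_ind _, fun _ _ => conjConstraint_ind Iff.rfl⟩
  | .next φ =>
    (((recurs_innerILP n φ).and recurs_lt).and (recurs_iff _)).mono fun _ _ H =>
      ⟨H.1.1, fun _ _ => isBinary_ind _, nextConstraint_ind H.1.2 H.2⟩
  | .until φ₁ φ₂ =>
    ((((recurs_innerILP n φ₁).and (recurs_innerILP n φ₂)).and recurs_lt).and
      ((recurs_iff _).and (recurs_untilBefore _ _))).mono fun _ _ H =>
        ⟨H.1.1.1, H.1.1.2, fun _ _ => isBinary_ind _, untilConstraint_ind H.1.2 H.2.1 H.2.2⟩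

/-! ### Counting propositions and outer formulas -/

theorem sum_ind_eq_ncard (P : Fin N → Prop) : ∑ n, (ind (P n) : ℝ) = Set.ncard {n | P n} := by
  classical
  simp [ind, Set.ncard_eq_toFinset_card']

/-- If the count reaches `m`, the strict bound holds because the count is at most `N < M`; otherwise
the lower bound holds because `m ≤ M`. -/
theorem counting_ind {M : ℝ} {m : ℕ} (hMN : (N : ℝ) + 1 ≤ M) (hm : (m : ℝ) ≤ M)
    (P : Fin N → Prop) :
    (m : ℝ) > ∑ n, (ind (P n) : ℝ) - M * (ind (m ≤ Set.ncard {n | P n}) : ℝ) ∧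
      ∑ n, (ind (P n) : ℝ) - M * (ind (m ≤ Set.ncard {n | P n}) : ℝ) ≥ (m : ℝ) - M := by
  rw [sum_ind_eq_ncard]
  have hN : (Set.ncard {n | P n} : ℝ) ≤ N := by
    exact_mod_cast (Set.ncard_le_card _).trans_eq (Nat.card_fin N)
  have h₀ : (0 : ℝ) ≤ m := m.cast_nonneg
  have h₁ : (0 : ℝ) ≤ Set.ncard {n | P n} := Nat.cast_nonneg _
  by_cases h : m ≤ Set.ncard {n | P n}
  · have h' : (m : ℝ) ≤ Set.ncard {n | P n} := by exact_mod_cast h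
    rw [ind_of_true h, Int.cast_one]
    constructor <;> linarith
  · have h' : (Set.ncard {n | P n} : ℝ) < m := by exact_mod_cast not_le.1 h
    rw [ind_of_false h, Int.cast_zero]
    constructor <;> linarith

theorem recurs_outerILP {M : ℝ} (hMN : (N : ℝ) + 1 ≤ M) : ∀ μ : Formula AP,
    (∀ m ∈ μ.thresholds, (m : ℝ) ≤ M) →
    Recurs fun l h => OuterILP T M h (truthVariables T p l h) μ
  | .tru, _ =>
    Recurs.of_atTop fun _ => Eventually.of_forall fun _ _ _ => ind_of_true trivial
  | .tcp φ m, hMm =>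
    (Recurs.forall fun n => recurs_innerILP T p n φ).mono fun _ _ H =>
      ⟨H, fun _ _ => ⟨isBinary_ind _, counting_ind hMN (hMm m rfl) _⟩⟩
  | .not μ, hMm =>
    (recurs_outerILP hMN μ hMm).mono fun _ _ H =>
      ⟨H, fun _ _ => isBinary_ind _, fun _ _ => ind_not _⟩
  | .and μ₁ μ₂, hMm =>
    ((recurs_outerILP hMN μ₁ fun m hm => hMm m (.inl hm)).and
      (recurs_outerILP hMN μ₂ fun m hm => hMm m (.inr hm))).mono
      fun _ _ H => ⟨H.1, H.2, fun _ _ => isBinary_ind _, fun _ _ => conjConstraint_ind Iff.rfl⟩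
  | .next μ, hMm =>
    (((recurs_outerILP hMN μ hMm).and recurs_lt).and (recurs_iff _)).mono fun _ _ H =>
      ⟨H.1.1, fun _ _ => isBinary_ind _, nextConstraint_ind H.1.2 H.2⟩
  | .until μ₁ μ₂, hMm =>
    ((((recurs_outerILP hMN μ₁ fun m hm => hMm m (.inl hm)).and
      (recurs_outerILP hMN μ₂ fun m hm => hMm m (.inr hm))).and
      recurs_lt).and ((recurs_iff _).and (recurs_untilBefore _ _))).mono fun _ _ H =>
        ⟨H.1.1.1, H.1.1.2, fun _ _ => isBinary_ind _, untilConstraint_ind H.1.2 H.2.1 H.2.2⟩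

end Assignment

end CLTL

theorem mainTheorem3 {AP : Type*} [Finite AP] {N : ℕ} {S : Fin N → Type*} [∀ n, Fintype (S n)]
    (T : ∀ n, CLTL.TransitionSystem (S n) AP) (s₀ : ∀ n, S n) (μ : CLTL.Formula AP)
    (M : ℝ) (hMN : (N : ℝ) + 1 ≤ M) (hMm : ∀ m ∈ μ.thresholds, (m : ℝ) ≤ M)
    (hsol : ∃ p : ∀ n, ℕ → S n, CLTL.IsSolution T s₀ μ p) :
    ∃ h : ℕ, 0 < h ∧ CLTL.Feasible T s₀ μ M h := by
  obtain ⟨p, hp, hμ⟩ := hsol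
  -- A single pair `l < h` meets all requirements at once, including equality of every robot's
  -- state.
  obtain ⟨l, h, ⟨hlh, hpl⟩, hILP⟩ := ((CLTL.recurs_lt.and
    (CLTL.Recurs.forall fun n => CLTL.recurs_eq (p n))).and
    (CLTL.recurs_outerILP T p hMN μ hMm)).exists
  exact ⟨h, Nat.zero_lt_of_lt hlh, CLTL.truthVariables T p l h,
    CLTL.dynamicsConstraints_truthVariables T p hp l h,
    CLTL.loopConstraints_truthVariables T p hlh hpl, hILP, CLTL.ind_of_true hμ⟩
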